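/- Let $0<s<1\le w$ be real numbers, let $X\subseteq\mathbb{R}\times[s,w-s]\subseteq\mathbb{R}^2$ be $s$-separated (that is, $\|x-x'\|_2\ge s$ for all distinct $x,x'\in X$), and let $Y\subseteq X$. Then there exists a mapping $\gamma=(\gamma_1,\gamma_2)\colon\mathbb{R}\to\mathbb{R}^2$ which is $\frac{2^{30}w^4}{s^4}$-bilipschitz, that is, with $L=\frac{2^{30}w^4}{s^4}$, $$\tfrac1L|t-t'|\le\|\gamma(t)-\gamma(t')\|_2\le L|t-t'|\qquad\text{for all }t,t'\in\mathbb{R},$$ such that the following statements hold: (i) $|\gamma_1(t)-t|\le\frac{24s}{100}$ and $0\le\gamma_2(t)\le w$ for all $t\in\mathbb{R}$. (ii) $\|x-\gamma(t)\|_2\ge\frac{2s}{100}$ for all $t\in\mathbb{R}$ and $x\in X$. (iii) The half-planes $\mathbb{R}\times(w,\infty)$ and $\mathbb{R}\times(-\infty,0)$ lie in two different connected components $W_+$ and $W_-$, respectively, of $\mathbb{R}^2\setminus\gamma(\mathbb{R})$, and $Y\subseteq W_-$ and $X\setminus Y\subseteq W_+$. -/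

import Mathlib

/-- A map is `L`-bilipschitz: it is `L`-Lipschitz, injective, and its inverse is `L`-Lipschitz
(injectivity is forced by the second inequality). -/
def IsBilipschitz {α β : Type*} [MetricSpace α] [MetricSpace β] (L : ℝ) (f : α → β) : Prop :=
  ∀ x y : α, dist (f x) (f y) ≤ L * dist x y ∧ dist x y ≤ L * dist (f x) (f y)

/-- A set is `r`-separated: distinct points are at distance at least `r` (not strictly more). -/
def IsSeparatedBy {α : Type*} [MetricSpace α] (r : ℝ) (A : Set α) : Prop :=
  ∀ a ∈ A, ∀ b ∈ A, a ≠ b → r ≤ dist a b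

/-- `C` is a connected component of the subset `F` of a topological space. -/
def IsComponentOf {α : Type*} [TopologicalSpace α] (C F : Set α) : Prop :=
  ∃ x ∈ F, C = connectedComponentIn F x

/-!
Draw a wave of wavelength slightly below `11 / 25 * s`, oscillating between the bottom and the top
of the strip. Moving each point of `X` horizontally by at most half a wavelength puts the points of
`Y` below crests and the other points above troughs. As `X` is `s`-separated, these displacements
form a Lipschitz function on `X` with constant `11 / 25`, which extends to a function `g` on the
plane with the same bound and the same constant. A Lipschitz constant below `1` makes
`(p 0 + g p, p 1)` bilipschitz coordinates on the plane, and the required curve is the wave drawn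
in these coordinates. It separates the plane because the graph of a continuous function does.
-/

open Function Real Set
open scoped NNReal

theorem IsBilipschitz.mono {α β : Type*} [MetricSpace α] [MetricSpace β] {f : α → β} {L L' : ℝ}
    (hf : IsBilipschitz L f) (hL : L ≤ L') : IsBilipschitz L' f := fun x y ↦
  ⟨(hf x y).1.trans (by gcongr), (hf x y).2.trans (by gcongr)⟩

theorem isBilipschitz_of_lipschitzWith_of_antilipschitzWith {α β : Type*} [MetricSpace α]
    [MetricSpace β] {f : α → β} {K K' : ℝ≥0} {L : ℝ} (hf : LipschitzWith K f)
    (hf' : AntilipschitzWith K' f) (hK : K ≤ L) (hK' : K' ≤ L) : IsBilipschitz L f := fun x y ↦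
  ⟨(hf.dist_le_mul x y).trans (by gcongr), (hf'.le_mul_dist x y).trans (by gcongr)⟩

section Components

variable {α β : Type*} [TopologicalSpace α] [TopologicalSpace β]

theorem isComponentOf_union_left {U V : Set α} (hUc : IsConnected U) (hU : IsOpen U)
    (hV : IsOpen V) (hUV : Disjoint U V) : IsComponentOf U (U ∪ V) := by
  obtain ⟨x, hx⟩ := hUc.nonempty
  refine ⟨x, Or.inl hx,
    (hUc.isPreconnected.subset_connectedComponentIn hx subset_union_left).antisymm ?_⟩
  exact isPreconnected_connectedComponentIn.subset_left_of_subset_union hU hV hUV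
    (connectedComponentIn_subset _ x) ⟨x, mem_connectedComponentIn (Or.inl hx), hx⟩

theorem IsComponentOf.preimage_homeomorph {C F : Set β} (h : IsComponentOf C F) (Φ : α ≃ₜ β) :
    IsComponentOf (Φ ⁻¹' C) (Φ ⁻¹' F) := by
  obtain ⟨y, hy, rfl⟩ := h
  refine ⟨Φ.symm y, by simpa using hy, ?_⟩
  simpa only [Homeomorph.image_symm] using Φ.symm.image_connectedComponentIn hy

end Components

section Graph

variable {α : Type*} {f : α → ℝ}

/-- The open region above the graph of `f`. -/
def strictEpigraph (f : α → ℝ) : Set (α × ℝ) := {z | f z.1 < z.2}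

/-- The open region below the graph of `f`. -/
def strictHypograph (f : α → ℝ) : Set (α × ℝ) := {z | z.2 < f z.1}

theorem disjoint_strictEpigraph_strictHypograph : Disjoint (strictEpigraph f) (strictHypograph f) :=
  disjoint_left.2 fun z (h : f z.1 < z.2) (h' : z.2 < f z.1) ↦ h.asymm h'

theorem strictEpigraph_union_strictHypograph :
    strictEpigraph f ∪ strictHypograph f = (range fun t ↦ (t, f t))ᶜ := by
  ext ⟨x, y⟩
  simp [strictEpigraph, strictHypograph, ← lt_or_lt_iff_ne]

theorem strictEpigraph_ne_strictHypograph [Nonempty α] : strictEpigraph f ≠ strictHypograph f := by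
  obtain ⟨x⟩ := ‹Nonempty α›
  have hx : (x, f x + 1) ∈ strictEpigraph f := lt_add_one (f x)
  exact disjoint_strictEpigraph_strictHypograph.ne (nonempty_of_mem hx).ne_empty

variable [TopologicalSpace α]

theorem isConnected_setOf_sub_mem [ConnectedSpace α] (hf : Continuous f) {J : Set ℝ}
    (hJ : IsConnected J) : IsConnected {z : α × ℝ | z.2 - f z.1 ∈ J} := by
  have h_image : {z : α × ℝ | z.2 - f z.1 ∈ J} = (fun z ↦ (z.1, z.2 + f z.1)) '' (univ ×ˢ J) := by
    ext ⟨x, y⟩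
    constructor
    · exact fun h ↦ ⟨(x, y - f x), ⟨mem_univ x, h⟩, by simp⟩
    · rintro ⟨⟨x', y'⟩, ⟨-, hy'⟩, h⟩
      obtain ⟨rfl, rfl⟩ := Prod.mk.inj h
      simpa using hy'
  rw [h_image]
  exact (isConnected_univ.prod hJ).image _ (by fun_prop)

theorem isOpen_strictEpigraph (hf : Continuous f) : IsOpen (strictEpigraph f) :=
  isOpen_lt (by fun_prop) (by fun_prop)

theorem isOpen_strictHypograph (hf : Continuous f) : IsOpen (strictHypograph f) :=
  isOpen_lt (by fun_prop) (by fun_prop)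

theorem isConnected_strictEpigraph [ConnectedSpace α] (hf : Continuous f) :
    IsConnected (strictEpigraph f) := by
  simpa [strictEpigraph] using isConnected_setOf_sub_mem hf (isConnected_Ioi (a := (0 : ℝ)))

theorem isConnected_strictHypograph [ConnectedSpace α] (hf : Continuous f) :
    IsConnected (strictHypograph f) := by
  simpa [strictHypograph] using isConnected_setOf_sub_mem hf (isConnected_Iio (a := (0 : ℝ)))

theorem isComponentOf_strictEpigraph [ConnectedSpace α] (hf : Continuous f) :
    IsComponentOf (strictEpigraph f) (range fun t ↦ (t, f t))ᶜ := by
  rw [← strictEpigraph_union_strictHypograph]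
  exact isComponentOf_union_left (isConnected_strictEpigraph hf) (isOpen_strictEpigraph hf)
    (isOpen_strictHypograph hf) disjoint_strictEpigraph_strictHypograph

theorem isComponentOf_strictHypograph [ConnectedSpace α] (hf : Continuous f) :
    IsComponentOf (strictHypograph f) (range fun t ↦ (t, f t))ᶜ := by
  rw [← strictEpigraph_union_strictHypograph, union_comm]
  exact isComponentOf_union_left (isConnected_strictHypograph hf) (isOpen_strictHypograph hf)
    (isOpen_strictEpigraph hf) disjoint_strictEpigraph_strictHypograph.symm

end Graph

section StraightenedGraph

section Topology

variable {α β E : Type*} [TopologicalSpace α] [TopologicalSpace β] [TopologicalSpace E]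

/-- The curve that the homeomorphism `Φ` straightens to the graph of `f`. -/
def straightenedGraph (Φ : E ≃ₜ α × β) (f : α → β) (t : α) : E := Φ.symm (t, f t)

theorem apply_straightenedGraph (Φ : E ≃ₜ α × β) (f : α → β) (t : α) :
    Φ (straightenedGraph Φ f t) = (t, f t) :=
  Φ.apply_symm_apply _

theorem range_straightenedGraph (Φ : E ≃ₜ α × β) (f : α → β) :
    range (straightenedGraph Φ f) = Φ ⁻¹' range fun t ↦ (t, f t) := by
  rw [← Φ.image_symm, ← range_comp]
  rfl

theorem isComponentOf_preimage_strictEpigraph [ConnectedSpace α] (Φ : E ≃ₜ α × ℝ) {f : α → ℝ}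
    (hf : Continuous f) :
    IsComponentOf (Φ ⁻¹' strictEpigraph f) (range (straightenedGraph Φ f))ᶜ := by
  simpa only [range_straightenedGraph] using!
    (isComponentOf_strictEpigraph hf).preimage_homeomorph Φ

theorem isComponentOf_preimage_strictHypograph [ConnectedSpace α] (Φ : E ≃ₜ α × ℝ) {f : α → ℝ}
    (hf : Continuous f) :
    IsComponentOf (Φ ⁻¹' strictHypograph f) (range (straightenedGraph Φ f))ᶜ := by
  simpa only [range_straightenedGraph] using!
    (isComponentOf_strictHypograph hf).preimage_homeomorph Φ

end Topology

theorem isBilipschitz_straightenedGraph {α β E : Type*} [MetricSpace α] [MetricSpace β]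
    [MetricSpace E] {Φ : E ≃ₜ α × β} {f : α → β} {K K' M : ℝ≥0} {L : ℝ} (hΦ : LipschitzWith K Φ)
    (hΦ' : AntilipschitzWith K' Φ) (hf : LipschitzWith M f) (hK : K ≤ L)
    (hK' : K' * max 1 M ≤ L) : IsBilipschitz L (straightenedGraph Φ f) := by
  have h_left : LeftInverse (Prod.fst ∘ Φ) (straightenedGraph Φ f) := fun t ↦ by
    rw [comp_apply, apply_straightenedGraph]
  refine isBilipschitz_of_lipschitzWith_of_antilipschitzWith
    ((hΦ'.to_rightInverse Φ.apply_symm_apply).comp (LipschitzWith.id.prodMk hf))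
    ((LipschitzWith.prod_fst.comp hΦ).to_rightInverse h_left) ?_ ?_
  · exact_mod_cast hK'
  · simpa using hK

end StraightenedGraph

section PerturbationOfIdentity

variable {E : Type*} [NormedAddCommGroup E] [NormedSpace ℝ E] {g : E → E} {K : ℝ≥0}

theorem approximatesLinearOn_id_add (hg : LipschitzWith K g) :
    ApproximatesLinearOn (fun x ↦ x + g x) (ContinuousLinearEquiv.refl ℝ E : E →L[ℝ] E) univ K :=
  fun x _ y _ ↦ by simpa [add_sub_add_comm] using hg.norm_sub_le x y

/-- The perturbation `x ↦ x + g x` of the identity by a contraction `g` of a Banach space. -/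
noncomputable def idAddHomeomorph [CompleteSpace E] (hg : LipschitzWith K g) (hK : K < 1) :
    E ≃ₜ E :=
  (approximatesLinearOn_id_add hg).toHomeomorph _ <| by
    rcases subsingleton_or_nontrivial E with hE | hE
    · exact Or.inl hE
    · right
      have h_norm : ‖(ContinuousLinearEquiv.refl ℝ E : E →L[ℝ] E)‖₊ = 1 :=
        ContinuousLinearMap.nnnorm_id
      rwa [ContinuousLinearEquiv.refl_symm, h_norm, inv_one]

end PerturbationOfIdentity

section Shear

variable {g : EuclideanSpace ℝ (Fin 2) → ℝ} {K : ℝ≥0}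

theorem lipschitzWith_euclideanSpace_single {α ι : Type*} [PseudoEMetricSpace α] [Fintype ι]
    [DecidableEq ι] {u : α → ℝ} {C : ℝ≥0} (hu : LipschitzWith C u) (i : ι) :
    LipschitzWith C fun x ↦ EuclideanSpace.single i (u x) := fun x y ↦ by
  simpa using hu x y

/-- The coordinates `(p 0 + g p, p 1)` on the plane, where `g` is a contraction. -/
noncomputable def shearCoords (hg : LipschitzWith K g) (hK : K < 1) :
    EuclideanSpace ℝ (Fin 2) ≃ₜ ℝ × ℝ :=
  (idAddHomeomorph (lipschitzWith_euclideanSpace_single hg 0) hK).trans <|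
    (PiLp.homeomorph 2 _).trans Homeomorph.finTwoArrow

theorem coe_shearCoords (hg : LipschitzWith K g) (hK : K < 1) :
    ⇑(shearCoords hg hK) =
      IsometryEquiv.piFinTwo (fun _ ↦ ℝ) ∘ WithLp.ofLp ∘
        fun p ↦ p + EuclideanSpace.single 0 (g p) :=
  rfl

theorem shearCoords_apply (hg : LipschitzWith K g) (hK : K < 1) (p : EuclideanSpace ℝ (Fin 2)) :
    shearCoords hg hK p = (p 0 + g p, p 1) := by
  simp [coe_shearCoords]

theorem lipschitzWith_shearCoords (hg : LipschitzWith K g) (hK : K < 1) :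
    LipschitzWith (1 + K) (shearCoords hg hK) := by
  simpa [coe_shearCoords] using (IsometryEquiv.piFinTwo fun _ ↦ ℝ).isometry.lipschitz.comp <|
    (PiLp.lipschitzWith_ofLp 2 _).comp <|
      LipschitzWith.id.add (lipschitzWith_euclideanSpace_single hg 0)

theorem antilipschitzWith_shearCoords (hg : LipschitzWith K g) (hK : K < 1) :
    AntilipschitzWith ((1 - K)⁻¹ * NNReal.sqrt 2) (shearCoords hg hK) := by
  have h_shear := AntilipschitzWith.id.add_lipschitzWith
    (lipschitzWith_euclideanSpace_single hg (0 : Fin 2)) (by simpa using hK)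
  simpa [coe_shearCoords, NNReal.sqrt_eq_rpow] using
    (IsometryEquiv.piFinTwo fun _ ↦ ℝ).isometry.antilipschitz.comp <|
      (PiLp.antilipschitzWith_ofLp 2 _).comp h_shear

end Shear

section PlateauWave

/-- A wave of wavelength `2 * π * c` between the heights `0` and `w`, equal to `w` near its
crests `cos (t / c) = 1` and to `0` near its troughs `cos (t / c) = -1`. It is a cosine wave of
twice the height, clipped, so that it is constant on intervals around its extrema. -/
noncomputable def plateauWave (w c t : ℝ) : ℝ := w * max 0 (min 1 (1 / 2 + cos (t / c)))

variable {w c t x y : ℝ}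

theorem plateauWave_nonneg (hw : 0 ≤ w) : 0 ≤ plateauWave w c t :=
  mul_nonneg hw (le_max_left _ _)

theorem plateauWave_le (hw : 0 ≤ w) : plateauWave w c t ≤ w :=
  mul_le_of_le_one_right hw (max_le zero_le_one (min_le_left _ _))

theorem plateauWave_of_half_le_cos (h : 1 / 2 ≤ cos (t / c)) : plateauWave w c t = w := by
  rw [plateauWave, min_eq_left (by linarith), max_eq_right zero_le_one, mul_one]

theorem plateauWave_of_cos_le_neg_half (h : cos (t / c) ≤ -(1 / 2)) : plateauWave w c t = 0 := by
  rw [plateauWave, max_eq_left (min_le_of_right_le (by linarith)), mul_zero]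

theorem abs_cos_div_sub_cos_div_le (hc : 0 < c) (x y : ℝ) :
    |cos (x / c) - cos (y / c)| ≤ |x - y| / c := by
  simpa only [← sub_div, abs_div, abs_of_pos hc] using abs_cos_sub_cos_le (x / c) (y / c)

theorem lipschitzWith_plateauWave (hw : 0 ≤ w) (hc : 0 < c) :
    LipschitzWith (w / c).toNNReal (plateauWave w c) := by
  refine LipschitzWith.of_dist_le_mul fun x y ↦ ?_
  have h_cos : LipschitzWith 1 fun θ ↦ max 0 (min 1 (1 / 2 + cos θ)) :=
    ((LipschitzWith.of_dist_le_mul fun x y ↦ by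
      simpa [Real.dist_eq] using abs_cos_sub_cos_le x y).const_min 1).const_max 0
  have h := h_cos.dist_le_mul (x / c) (y / c)
  rw [coe_toNNReal _ (by positivity), plateauWave, plateauWave, Real.dist_eq, ← mul_sub, abs_mul,
    abs_of_nonneg hw, div_mul_eq_mul_div, mul_div_assoc]
  gcongr
  simpa [Real.dist_eq, ← sub_div, abs_div, abs_of_pos hc] using h

theorem plateauWave_of_near_crest (hc : 0 < c) (hx : cos (x / c) = 1) (hxt : |x - t| ≤ c / 2) :
    plateauWave w c t = w := by
  have h_cos : |cos (x / c) - cos (t / c)| ≤ 1 / 2 :=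
    (abs_cos_div_sub_cos_div_le hc x t).trans ((div_le_iff₀ hc).2 (by linarith))
  exact plateauWave_of_half_le_cos (by linarith [(abs_le.1 h_cos).2])

theorem plateauWave_of_near_trough (hc : 0 < c) (hx : cos (x / c) = -1) (hxt : |x - t| ≤ c / 2) :
    plateauWave w c t = 0 := by
  have h_cos : |cos (x / c) - cos (t / c)| ≤ 1 / 2 :=
    (abs_cos_div_sub_cos_div_le hc x t).trans ((div_le_iff₀ hc).2 (by linarith))
  exact plateauWave_of_cos_le_neg_half (by linarith [(abs_le.1 h_cos).1])

theorem half_le_dist_plateauWave_of_crest (hc : 0 < c) (hx : cos (x / c) = 1)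
    (hy : y + c / 2 ≤ w) : c / 2 ≤ dist (x, y) (t, plateauWave w c t) := by
  rw [Prod.dist_eq, Real.dist_eq, Real.dist_eq, le_max_iff, or_iff_not_imp_left, not_le]
  intro hxt
  rw [plateauWave_of_near_crest hc hx hxt.le]
  linarith [neg_le_abs (y - w)]

theorem half_le_dist_plateauWave_of_trough (hc : 0 < c) (hx : cos (x / c) = -1)
    (hy : c / 2 ≤ y) : c / 2 ≤ dist (x, y) (t, plateauWave w c t) := by
  rw [Prod.dist_eq, Real.dist_eq, Real.dist_eq, le_max_iff, or_iff_not_imp_left, not_le]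
  intro hxt
  rw [plateauWave_of_near_trough hc hx hxt.le]
  linarith [le_abs_self (y - 0)]

end PlateauWave

section Displacement

theorem exists_abs_le_half_period_apply_add_eq {β : Type*} {f : ℝ → β} {P : ℝ} (hf : Periodic f P)
    (hP : 0 < P) (x y : ℝ) : ∃ d, |d| ≤ P / 2 ∧ f (x + d) = f y := by
  obtain ⟨z, hz, hfz⟩ := hf.exists_mem_Ico hP y (x - P / 2)
  refine ⟨z - x, abs_le.2 ⟨?_, ?_⟩, by rw [add_sub_cancel, hfz]⟩ <;> linarith [hz.1, hz.2]

variable {α : Type*} [MetricSpace α] {X : Set α} {s : ℝ} {K : ℝ≥0}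

theorem IsSeparatedBy.exists_lipschitzWith_eqOn (hX : IsSeparatedBy s X) {d : α → ℝ} {R : ℝ}
    (hR : 0 ≤ R) (hd : ∀ p ∈ X, |d p| ≤ R) (hK : 2 * R ≤ K * s) :
    ∃ g : α → ℝ, LipschitzWith K g ∧ (∀ p, |g p| ≤ R) ∧ EqOn g d X := by
  have hdK : LipschitzOnWith K d X := by
    refine LipschitzOnWith.of_dist_le_mul fun p hp q hq ↦ ?_
    rcases eq_or_ne p q with rfl | hpq
    · simp
    · calc dist (d p) (d q) ≤ |d p| + |d q| := abs_sub (d p) (d q)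
        _ ≤ K * s := by linarith [hd p hp, hd q hq]
        _ ≤ K * dist p q := by gcongr; exact hX p hp q hq hpq
  obtain ⟨g, hg, hgd⟩ := hdK.extend_real
  refine ⟨fun p ↦ max (-R) (min R (g p)), (hg.const_min R).const_max (-R), fun p ↦ ?_,
    fun p hp ↦ ?_⟩
  · exact abs_le.2 ⟨le_max_left _ _, max_le (by linarith) (min_le_left _ _)⟩
  · obtain ⟨h_lower, h_upper⟩ := abs_le.1 (hd p hp)
    simp only [← hgd hp, min_eq_right h_upper, max_eq_right h_lower]

theorem IsSeparatedBy.exists_lipschitzWith_apply_add_eq (hX : IsSeparatedBy s X) {β : Type*}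
    {f : ℝ → β} {P : ℝ} (hf : Periodic f P) (hP : 0 < P) (hK : P ≤ K * s) (u v : α → ℝ) :
    ∃ g : α → ℝ, LipschitzWith K g ∧ (∀ p, |g p| ≤ P / 2) ∧
      ∀ p ∈ X, f (u p + g p) = f (v p) := by
  choose d hd hfd using fun p ↦ exists_abs_le_half_period_apply_add_eq hf hP (u p) (v p)
  obtain ⟨g, hg, hgP, hgd⟩ :=
    hX.exists_lipschitzWith_eqOn (K := K) (half_pos hP).le (fun p _ ↦ hd p) (by linarith)
  exact ⟨g, hg, hgP, fun p hp ↦ by rw [hgd hp, hfd]⟩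

theorem IsSeparatedBy.exists_lipschitzWith_cos_eq (hX : IsSeparatedBy s X) {c : ℝ} (hc : 0 < c)
    (hK : 2 * π * c ≤ K * s) (u : α → ℝ) (Y : Set α) :
    ∃ g : α → ℝ, LipschitzWith K g ∧ (∀ p, |g p| ≤ π * c) ∧
      (∀ p ∈ X ∩ Y, cos ((u p + g p) / c) = 1) ∧ ∀ p ∈ X \ Y, cos ((u p + g p) / c) = -1 := by
  classical
  obtain ⟨g, hg, hgc, hgX⟩ := hX.exists_lipschitzWith_apply_add_eq (cos_periodic.div_const c)
    (by positivity) hK u fun p ↦ if p ∈ Y then 0 else π * c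
  refine ⟨g, hg, fun p ↦ (hgc p).trans_eq (by ring), fun p hp ↦ ?_, fun p hp ↦ ?_⟩
  · rw [hgX p hp.1, if_pos hp.2, zero_div, cos_zero]
  · rw [hgX p hp.1, if_neg hp.2, mul_div_cancel_right₀ π hc.ne', cos_pi]

end Displacement

section ShearedWave

variable {g : EuclideanSpace ℝ (Fin 2) → ℝ} {K : ℝ≥0} (hg : LipschitzWith K g) (hK : K < 1)
  {w c s : ℝ} {p : EuclideanSpace ℝ (Fin 2)}

/-- The plateau wave of height `w` and wavelength `2 * π * c`, drawn in the coordinates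
`(p 0 + g p, p 1)` on the plane. -/
noncomputable def shearedWave (w c : ℝ) : ℝ → EuclideanSpace ℝ (Fin 2) :=
  straightenedGraph (shearCoords hg hK) (plateauWave w c)

theorem shearCoords_shearedWave (t : ℝ) :
    shearCoords hg hK (shearedWave hg hK w c t) = (t, plateauWave w c t) :=
  apply_straightenedGraph _ _ t

theorem abs_shearedWave_apply_zero_sub (t : ℝ) :
    |shearedWave hg hK w c t 0 - t| = |g (shearedWave hg hK w c t)| := by
  have h_abscissa : shearedWave hg hK w c t 0 + g (shearedWave hg hK w c t) = t := by
    simpa [shearCoords_apply] using congrArg Prod.fst (shearCoords_shearedWave hg hK t)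
  rw [← abs_neg, neg_sub, ← eq_sub_of_add_eq' h_abscissa]

theorem shearedWave_apply_one (t : ℝ) : shearedWave hg hK w c t 1 = plateauWave w c t := by
  simpa [shearCoords_apply] using congrArg Prod.snd (shearCoords_shearedWave hg hK t)

theorem mem_preimage_strictEpigraph_iff {f : ℝ → ℝ} :
    p ∈ shearCoords hg hK ⁻¹' strictEpigraph f ↔ f (p 0 + g p) < p 1 := by
  rw [mem_preimage, shearCoords_apply]
  rfl

theorem mem_preimage_strictHypograph_iff {f : ℝ → ℝ} :
    p ∈ shearCoords hg hK ⁻¹' strictHypograph f ↔ p 1 < f (p 0 + g p) := by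
  rw [mem_preimage, shearCoords_apply]
  rfl

theorem half_le_mul_dist_shearedWave (hc : 0 < c)
    (hp : cos ((p 0 + g p) / c) = 1 ∧ p 1 + c / 2 ≤ w ∨
      cos ((p 0 + g p) / c) = -1 ∧ c / 2 ≤ p 1) (t : ℝ) :
    c / 2 ≤ (1 + K) * dist p (shearedWave hg hK w c t) := by
  calc c / 2 ≤ dist (p 0 + g p, p 1) (t, plateauWave w c t) := by
        rcases hp with ⟨h_crest, h_below⟩ | ⟨h_trough, h_above⟩
        · exact half_le_dist_plateauWave_of_crest hc h_crest h_below
        · exact half_le_dist_plateauWave_of_trough hc h_trough h_above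
    _ = dist (shearCoords hg hK p) (shearCoords hg hK (shearedWave hg hK w c t)) := by
        rw [shearCoords_apply hg hK p, shearCoords_shearedWave]
    _ ≤ (1 + K) * dist p (shearedWave hg hK w c t) :=
        (lipschitzWith_shearCoords hg hK).dist_le_mul _ _

theorem isBilipschitz_shearedWave (hs : 0 < s) (hsw : s ≤ w) {g : EuclideanSpace ℝ (Fin 2) → ℝ}
    (hg : LipschitzWith (11 / 25) g) (hK : (11 / 25 : ℝ≥0) < 1) :
    IsBilipschitz (40 * w / s) (shearedWave hg hK w (7 / 100 * s)) := by
  have hw : 0 ≤ w := hs.le.trans hsw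
  have h_ratio : 1 ≤ w / s := (one_le_div hs).2 hsw
  have h_slope : w / (7 / 100 * s) = 100 / 7 * (w / s) := by field_simp
  have h_inv : (((1 - 11 / 25)⁻¹ : ℝ≥0) : ℝ) = 25 / 14 := by
    rw [NNReal.coe_inv, NNReal.coe_sub hK.le]
    norm_num
  have h_sqrt : √2 ≤ 3 / 2 := by rw [Real.sqrt_le_left] <;> norm_num
  rw [mul_div_assoc]
  refine isBilipschitz_straightenedGraph (lipschitzWith_shearCoords hg hK)
    (antilipschitzWith_shearCoords hg hK)
    (lipschitzWith_plateauWave hw (by positivity)) ?_ ?_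
  · push_cast
    linarith
  · rw [NNReal.coe_mul, h_inv, Real.coe_sqrt, NNReal.coe_max, coe_toNNReal _ (by positivity),
      h_slope, NNReal.coe_one, max_eq_right (by linarith)]
    push_cast
    nlinarith

end ShearedWave

theorem forty_mul_div_le {s w : ℝ} (hs : 0 < s) (hsw : s ≤ w) :
    40 * w / s ≤ 2 ^ 30 * w ^ 4 / s ^ 4 := by
  have h_ratio : 1 ≤ w / s := (one_le_div hs).2 hsw
  calc 40 * w / s = 40 * (w / s) := mul_div_assoc _ _ _
    _ ≤ 2 ^ 30 * (w / s) ^ 4 := by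
      gcongr
      · norm_num
      · exact le_self_pow₀ h_ratio (by norm_num)
    _ = 2 ^ 30 * w ^ 4 / s ^ 4 := by rw [div_pow, mul_div_assoc]

theorem mainTheorem6_general (s w : ℝ) (hs : 0 < s) (hsw : s ≤ w)
    (X Y : Set (EuclideanSpace ℝ (Fin 2)))
    (hXstrip : ∀ x ∈ X, x 1 ∈ Set.Icc s (w - s))
    (hXsep : IsSeparatedBy s X) (hYX : Y ⊆ X) :
    ∃ γ : ℝ → EuclideanSpace ℝ (Fin 2),
      IsBilipschitz (40 * w / s) γ ∧
      (∀ t : ℝ, |γ t 0 - t| ≤ 24 * s / 100 ∧ 0 ≤ γ t 1 ∧ γ t 1 ≤ w) ∧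
      (∀ t : ℝ, ∀ x ∈ X, 2 * s / 100 ≤ dist x (γ t)) ∧
      ∃ Wplus Wminus : Set (EuclideanSpace ℝ (Fin 2)),
        IsComponentOf Wplus (Set.range γ)ᶜ ∧
        IsComponentOf Wminus (Set.range γ)ᶜ ∧
        Wplus ≠ Wminus ∧
        {p : EuclideanSpace ℝ (Fin 2) | w < p 1} ⊆ Wplus ∧
        {p : EuclideanSpace ℝ (Fin 2) | p 1 < 0} ⊆ Wminus ∧
        Y ⊆ Wminus ∧ X \ Y ⊆ Wplus := by
  set c := 7 / 100 * s with hc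
  have hc0 : 0 < c := by linarith
  have hw : 0 ≤ w := hs.le.trans hsw
  have hK : (11 / 25 : ℝ≥0) < 1 := by rw [← NNReal.coe_lt_coe]; norm_num
  have h_period : 2 * π * c ≤ (11 / 25 : ℝ≥0) * s := by push_cast; nlinarith [pi_lt_d4]
  obtain ⟨g, hg, hgc, h_crest, h_trough⟩ := hXsep.exists_lipschitzWith_cos_eq hc0 h_period (· 0) Y
  have hf : Continuous (plateauWave w c) := (lipschitzWith_plateauWave hw hc0).continuous
  refine ⟨shearedWave hg hK w c, isBilipschitz_shearedWave hs hsw hg hK,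
    fun t ↦ ⟨?_, ?_, ?_⟩, fun t p hp ↦ ?_,
    shearCoords hg hK ⁻¹' strictEpigraph (plateauWave w c),
    shearCoords hg hK ⁻¹' strictHypograph (plateauWave w c),
    isComponentOf_preimage_strictEpigraph _ hf, isComponentOf_preimage_strictHypograph _ hf,
    (shearCoords hg hK).surjective.preimage_injective.ne strictEpigraph_ne_strictHypograph, ?_⟩
  · push_cast at h_period
    exact (abs_shearedWave_apply_zero_sub hg hK t).trans_le ((hgc _).trans (by linarith))
  · exact (plateauWave_nonneg hw).trans_eq (shearedWave_apply_one hg hK t).symm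
  · exact (shearedWave_apply_one hg hK t).trans_le (plateauWave_le hw)
  · obtain ⟨h_bottom, h_top⟩ := hXstrip p hp
    have h_dist : c / 2 ≤ (1 + (11 / 25 : ℝ≥0)) * dist p (shearedWave hg hK w c t) := by
      refine half_le_mul_dist_shearedWave hg hK hc0 ?_ t
      by_cases hpY : p ∈ Y
      · exact Or.inl ⟨h_crest p ⟨hp, hpY⟩, by linarith⟩
      · exact Or.inr ⟨h_trough p ⟨hp, hpY⟩, by linarith⟩
    push_cast at h_dist
    linarith
  · simp only [subset_def, mem_preimage_strictEpigraph_iff, mem_preimage_strictHypograph_iff]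
    refine ⟨fun p hp ↦ (plateauWave_le hw).trans_lt hp,
      fun p hp ↦ hp.trans_le (plateauWave_nonneg hw), fun p hp ↦ ?_, fun p hp ↦ ?_⟩
    · rw [plateauWave_of_half_le_cos (by norm_num [h_crest p ⟨hYX hp, hp⟩])]
      linarith [(hXstrip p (hYX hp)).2]
    · rw [plateauWave_of_cos_le_neg_half (by norm_num [h_trough p hp])]
      linarith [(hXstrip p hp.1).1]

theorem mainTheorem6 (s w : ℝ) (hs0 : 0 < s) (hs1 : s < 1) (hw : 1 ≤ w)
    (X Y : Set (EuclideanSpace ℝ (Fin 2)))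
    (hXstrip : ∀ x ∈ X, x 1 ∈ Set.Icc s (w - s))
    (hXsep : IsSeparatedBy s X) (hYX : Y ⊆ X) :
    ∃ γ : ℝ → EuclideanSpace ℝ (Fin 2),
      IsBilipschitz (2 ^ 30 * w ^ 4 / s ^ 4) γ ∧
      (∀ t : ℝ, |γ t 0 - t| ≤ 24 * s / 100 ∧ 0 ≤ γ t 1 ∧ γ t 1 ≤ w) ∧
      (∀ t : ℝ, ∀ x ∈ X, 2 * s / 100 ≤ dist x (γ t)) ∧
      ∃ Wplus Wminus : Set (EuclideanSpace ℝ (Fin 2)),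
        IsComponentOf Wplus (Set.range γ)ᶜ ∧
        IsComponentOf Wminus (Set.range γ)ᶜ ∧
        Wplus ≠ Wminus ∧
        {p : EuclideanSpace ℝ (Fin 2) | w < p 1} ⊆ Wplus ∧
        {p : EuclideanSpace ℝ (Fin 2) | p 1 < 0} ⊆ Wminus ∧
        Y ⊆ Wminus ∧ X \ Y ⊆ Wplus := by
  obtain ⟨γ, hγ, h⟩ := mainTheorem6_general s w hs0 (hs1.le.trans hw) X Y hXstrip hXsep hYX
  exact ⟨γ, hγ.mono (forty_mul_div_le hs0 (hs1.le.trans hw)), h⟩
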